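/- Let $K$ be a field, $n\ge 1$ and $r\in\mathbb Z$. Order $\mathbb Z^n$ by the reverse lexicographic order ($a<b$ iff $a_i<b_i$ at the largest index $i$ with $a_i\neq b_i$), and let $K\langle\langle z_1,\dots,z_n\rangle\rangle$ be the field of Malcev–Neumann series on $\mathbb Z^n$, that is, of formal series $\sum_{m\in\mathbb Z^n}c_m z^m$ ($c_m\in K$) whose support is well-ordered; equivalently, the field of iterated Laurent series. The initial term of a nonzero series is its term of least order, and $\mathrm{CT}_{z}$ is the coefficient of $z^0$. For nonzero $F_1,\dots,F_n$ in this field with initial terms $a_i z_1^{b_{i1}}\cdots z_n^{b_{in}}$, the Jacobian number is $j(F)=\det(b_{ij})$ and the log Jacobian is $LJ(F)=\frac{z_1\cdots z_n}{F_1\cdots F_n}\det\left(\frac{\partial F_i}{\partial z_j}\right)$. For $1\le j\le n$ put $$u_j^{(r)}=(-1)^{j-1}z_j^{\,r}\,\Delta_j(z),\qquad \Delta_j(z)=\prod_{\substack{1\le i<k\le n\\ i,k\ne j}}(z_i-z_k).$$ Let $\rho:\mathbb Z^n\to\mathbb Z^n$ be the homomorphism sending the exponent vector of $z_i$ to the exponent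 vector of the initial term of $u_i^{(r)}$, for all $i$. 1. The log Jacobian of $u_1^{(r)},\dots,u_n^{(r)}$ is a constant, equal to their Jacobian number $$j(r)=r(r-1)\cdots(r-n+2)\left(r+\binom{n-1}{2}\right).$$ 2. Suppose $r\notin\{0,1,\dots,n-2\}$ and $r\neq-\binom{n-1}{2}$. Then $\rho$ is injective. Let $K^\rho\langle\langle z\rangle\rangle$ be the set of formal series $\Phi=\sum_{k\in\mathbb Z^n}a_k z^k$ whose support is well-ordered with respect to the induced total order $k\le^\rho l\iff\rho(k)\le\rho(l)$. For every $\Phi\in K^\rho\langle\langle z\rangle\rangle$ the series $$\Phi(u_1^{(r)},\dots,u_n^{(r)})=\sum_{k\in\mathbb Z^n}a_k\,(u_1^{(r)})^{k_1}\cdots(u_n^{(r)})^{k_n}$$ exists in $K\langle\langle z\rangle\rangle$ (each coefficient is nonzero in only finitely many summands, and the sum has well-ordered support), and $$\mathrm{CT}_{z}\,\Phi(u_1^{(r)},\dots,u_n^{(r)})=\mathrm{CT}_{u^{(r)}}\,\Phi(u_1^{(r)},\dots,u_n^{(r)}),$$ where the right-hand side denotes the constant coefficient $a_0$ of $\Phi$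 as an element of $K^\rho\langle\langle z\rangle\rangle$. In particular, for $n\ge 2$, this holds for $r=n-1$. -/

import Mathlib

noncomputable section

namespace MalcevNeumann

/-- The totally ordered abelian group `ℤⁿ` with the reverse lexicographic order: `a < b` iff
`a i < b i` at the largest index `i` with `a i ≠ b i`. (Lexicographic order for the dual order
on the indices.) -/
abbrev ExpGroup (n : ℕ) : Type := Lex ((Fin n)ᵒᵈ → ℤ)

/-- The `i`-th coordinate of an exponent vector. -/
def ExpGroup.coord {n : ℕ} (m : ExpGroup n) (i : Fin n) : ℤ := ofLex m (OrderDual.toDual i)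

/-- The `j`-th standard basis vector of `ℤⁿ`, the exponent vector of `zⱼ`. -/
def ExpGroup.basis {n : ℕ} (j : Fin n) : ExpGroup n := toLex (Pi.single (OrderDual.toDual j) 1)

/-- The field `K⟪z₁, …, zₙ⟫` of iterated Laurent series, as the field of Malcev-Neumann series
on `ℤⁿ` (Hahn series: formal series with well-ordered support). -/
abbrev MNSeries (n : ℕ) (K : Type*) [Field K] : Type _ := HahnSeries (ExpGroup n) K

variable {n : ℕ} {K : Type*} [Field K]

/-- The variable `zⱼ`. -/
def var (K : Type*) [Field K] (j : Fin n) : MNSeries n K :=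
  HahnSeries.single (ExpGroup.basis j) 1

/-- The partial derivative `∂/∂zⱼ`, acting termwise. -/
def pderiv (j : Fin n) (η : MNSeries n K) : MNSeries n K where
  coeff m := ((m.coord j + 1 : ℤ) : K) * η.coeff (m + ExpGroup.basis j)
  isPWO_support' := by
    have h : ((fun m : ExpGroup n => m - ExpGroup.basis j) '' η.support).IsPWO :=
      η.isPWO_support.image_of_monotone fun _ _ hab => sub_le_sub_right hab _
    refine h.mono fun m hm => ⟨m + ExpGroup.basis j, ?_, add_sub_cancel_right _ _⟩
    exact right_ne_zero_of_mul (Function.mem_support.1 hm)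

/-- The constant term `CT_z η`. -/
def constTerm (η : MNSeries n K) : K := η.coeff 0

/-- The exponent of `zⱼ` in the initial term (the term of least order) of `Fᵢ`. -/
def expMatrix (F : Fin n → MNSeries n K) : Matrix (Fin n) (Fin n) ℤ :=
  Matrix.of fun i j => (F i).order.coord j

/-- The Jacobian number `j(F₁, …, Fₙ)`. -/
def jacobianNumber (F : Fin n → MNSeries n K) : ℤ := (expMatrix F).det

/-- The log Jacobian `(z₁ ⋯ zₙ) / (F₁ ⋯ Fₙ) · det (∂Fᵢ/∂zⱼ)`. -/
def logJacobian (F : Fin n → MNSeries n K) : MNSeries n K :=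
  (∏ i, var K i) / (∏ i, F i) * (Matrix.of fun i j => pderiv j (F i)).det

/-- The endomorphism `ρ` of `ℤⁿ` sending the exponent vector of `zᵢ` to that of the initial
term of `Fᵢ`. -/
def initialHom (F : Fin n → MNSeries n K) : (Fin n → ℤ) →+ ExpGroup n where
  toFun k := ∑ i, k i • (F i).order
  map_zero' := by simp
  map_add' a b := by simp [add_smul, Finset.sum_add_distrib]

/-- Formal series `∑ₖ Φ(k) z^k` over all `k ∈ ℤⁿ`, without condition on the support. -/
abbrev FormalSeries (n : ℕ) (K : Type*) : Type _ := (Fin n → ℤ) → K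

/-- `Φ ∈ K^ρ⟪z₁, …, zₙ⟫`: the support of `Φ` is well-ordered under the induced order
`k ≤^ρ l ↔ ρ k ≤ ρ l` (a total order on `ℤⁿ` when `ρ` is injective). -/
def IsInducedMN (ρ : (Fin n → ℤ) →+ ExpGroup n) (Φ : FormalSeries n K) : Prop :=
  (Function.support Φ).WellFoundedOn (fun k l => ρ k < ρ l)

/-- The constant term of a formal series. -/
def FormalSeries.constTerm (Φ : FormalSeries n K) : K := Φ 0

/-- Strict convergence: `∑ᵢ ηᵢ` strictly converges to `η` if each coefficient is nonzero in only
finitely many of the `ηᵢ`, and the coefficientwise finite sums are the coefficients of `η`. -/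
def HasStrictSum {ι : Type*} (η' : ι → MNSeries n K) (η : MNSeries n K) : Prop :=
  ∀ g, {i | (η' i).coeff g ≠ 0}.Finite ∧ ∑ᶠ i, (η' i).coeff g = η.coeff g

/-- `Φ(F₁, …, Fₙ) = ∑ₖ Φ(k) F₁^{k₁} ⋯ Fₙ^{kₙ}` exists in `K⟪z₁, …, zₙ⟫` and equals `η`. -/
def HasComp (Φ : FormalSeries n K) (F : Fin n → MNSeries n K) (η : MNSeries n K) : Prop :=
  HasStrictSum (fun k : Fin n → ℤ => Φ k • ∏ i, F i ^ k i) η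

/-- The Vandermonde product `Δⱼ(z) = ∏_{i < k, i ≠ j ≠ k} (zᵢ - zₖ)` omitting `zⱼ`. -/
def vandermondeOmit (K : Type*) [Field K] (j : Fin n) : MNSeries n K :=
  ∏ p : Fin n × Fin n with p.1 < p.2 ∧ p.1 ≠ j ∧ p.2 ≠ j, (var K p.1 - var K p.2)

/-- The change of variables `uⱼ^{(r)} = (-1)^{j-1} zⱼ^r Δⱼ(z)`; indices start at `0`, so the
sign is `(-1)^j`. -/
def dysonVar (K : Type*) [Field K] (n : ℕ) (r : ℤ) (j : Fin n) : MNSeries n K :=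
  (-1) ^ (j : ℕ) * var K j ^ r * vandermondeOmit K j

end MalcevNeumann

end

/-!
Write `θ_j = z_j ∂/∂z_j`. The log Jacobian of `F₁, …, Fₙ` is the determinant of the matrix `L` of
logarithmic derivatives `θ_j F_i / F_i` (`logJacobian_eq_det`). Three facts make the theorem true.

*The log Jacobian of the `u_i` is constant.* Here `L` has diagonal entries `r` and off-diagonal
entries `∑_{k ≠ i, j} z_j / (z_j - z_k)`. Applied to the vector `(z_j^m)_j`, the poles combine to
divided differences, which are polynomials, and `L V = V T` for the Vandermonde matrix `V` and an
upper triangular matrix `T` with the diagonal entries `r + binom(n-1, 2)` and `r, …, r - n + 2`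
(`det_dysonLogMatrix`). The matrix of initial exponents arises from `L` when each
`z_j / (z_j - z_k)` is replaced by `1` or `0` according to whether `j < k`, and is triangularized
similarly by the vectors `e₀ + ⋯ + e_m` (`det_dysonExpMatrix`). So `ρ` is injective when `j(r) ≠ 0`.

*Convergence.* The support of `u^k` lies in `ρ(k) + S`, where `S` is the monoid generated by the
exponents of the `z_b / z_a` with `a < b` (`HasInitial`, `hasInitial_dysonVar`). It is well-ordered,
and so is `ρ(supp Φ) + S`, with finite fibres over the pairs of summands (`exists_hasComp`).

*Constant terms.* By strict convergence, it remains to show `CT u^k = 0` for `k ≠ 0`. For any `Fᵢ`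
and any `i`, the series `k_i F^k det L` is the divergence `∑_j θ_j (F^k C_{ij})`, where the row
`(C_{ij})_j` of cofactors has divergence zero because mixed derivatives agree; and the constant term
of a `θ_j`-derivative is zero (`zsmul_map_monomial_mul_det_eq_zero`). Over `ℚ` the constant
`det L = j(r) ≠ 0` can be cancelled. Since `u^k` comes from one series with integer coefficients for
all fields, `CT u^k = 0` also when the characteristic divides `j(r)`
(`coeff_zero_prod_dysonVar_zpow`).
-/

noncomputable section

namespace MalcevNeumann

/-! ### Logarithmic derivatives -/

section LogDeriv

variable {F : Type*} [Field F]

/-- The derivations of a field `F` into itself, for the ring structure that underlies the field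
structure; this singles out one of the instance paths on Hahn series. -/
abbrev FieldDerivation (F : Type*) [Field F] : Type _ := Derivation ℤ F F

/-- The logarithmic derivative `D a / a` of `a` for the derivation `D`. -/
def logDer (D : FieldDerivation F) (a : F) : F := D a / a

lemma deriv_eq_mul_logDer (D : FieldDerivation F) {a : F} (ha : a ≠ 0) :
    D a = a * logDer D a := by
  rw [logDer, mul_div_cancel₀ _ ha]

lemma logDer_mul (D : FieldDerivation F) {a b : F} (ha : a ≠ 0) (hb : b ≠ 0) :
    logDer D (a * b) = logDer D a + logDer D b := by
  simp only [logDer, Derivation.leibniz, smul_eq_mul]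
  field_simp
  ring

lemma logDer_one (D : FieldDerivation F) : logDer D 1 = 0 := by simp [logDer]

lemma logDer_neg (D : FieldDerivation F) (a : F) : logDer D (-a) = logDer D a := by
  simp [logDer]

lemma logDer_prod (D : FieldDerivation F) {ι : Type*} (s : Finset ι) (f : ι → F)
    (h : ∀ i ∈ s, f i ≠ 0) : logDer D (∏ i ∈ s, f i) = ∑ i ∈ s, logDer D (f i) := by
  classical
  induction s using Finset.induction_on with
  | empty => simp [logDer_one]
  | insert a s ha ih =>
    rw [Finset.prod_insert ha, Finset.sum_insert ha, logDer_mul D (h a (by simp))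
      (Finset.prod_ne_zero_iff.2 fun i hi => h i (by simp [hi])),
      ih fun i hi => h i (by simp [hi])]

lemma logDer_zpow (D : FieldDerivation F) {a : F} (ha : a ≠ 0) (k : ℤ) :
    logDer D (a ^ k) = k * logDer D a := by
  rw [logDer, Derivation.leibniz_zpow, logDer, zpow_sub_one₀ ha]
  simp only [zsmul_eq_mul, smul_eq_mul]
  have := zpow_ne_zero k ha
  field_simp

lemma logDer_comm {D D' : FieldDerivation F} (hc : ∀ x, D (D' x) = D' (D x)) (a : F) :
    D (logDer D' a) = D' (logDer D a) := by
  rcases eq_or_ne a 0 with rfl | ha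
  · simp [logDer]
  have h1 := congrArg D (deriv_eq_mul_logDer D' ha)
  have h2 := congrArg D' (deriv_eq_mul_logDer D ha)
  rw [Derivation.leibniz, smul_eq_mul, smul_eq_mul, deriv_eq_mul_logDer D ha] at h1
  rw [Derivation.leibniz, smul_eq_mul, smul_eq_mul, deriv_eq_mul_logDer D' ha] at h2
  have h3 := h1.symm.trans ((hc a).trans h2)
  refine mul_left_cancel₀ ha ?_
  linear_combination h3

end LogDeriv

/-! ### The change of variables formula for residues -/

section Residue

variable {F : Type*} [Field F] {ι : Type*} [Fintype ι] [DecidableEq ι]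

/-- The matrix of logarithmic derivatives `D_j f_i / f_i`. -/
def logJacobianMatrix (D : ι → FieldDerivation F) (f : ι → F) : Matrix ι ι F :=
  Matrix.of fun i j => logDer (D j) (f i)

/-- The rows of the cofactor matrix of a Jacobian matrix have divergence zero: the terms of the
divergence cancel in pairs, because mixed derivatives agree. -/
lemma sum_sign_mul_deriv_prod_eq_zero (D : ι → FieldDerivation F) (L : Matrix ι ι F)
    (hL : ∀ i j j', D j (L i j') = D j' (L i j)) (i₀ : ι) :
    ∑ σ : Equiv.Perm ι, (Equiv.Perm.sign σ : ℤ) •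
      D (σ i₀) (∏ i ∈ Finset.univ.erase i₀, L i (σ i)) = 0 := by
  have hD : ∀ (d : FieldDerivation F) (s : Finset ι) (g : ι → F), d (∏ i ∈ s, g i) =
      ∑ i ∈ s, (∏ l ∈ s.erase i, g l) * d (g i) := by
    intro d s g
    induction s using Finset.induction_on with
    | empty => simp
    | insert a s ha ih =>
      rw [Finset.prod_insert ha, Finset.sum_insert ha, Derivation.leibniz, ih,
        Finset.erase_insert ha, smul_eq_mul, smul_eq_mul, add_comm, Finset.mul_sum]
      congr 1
      refine Finset.sum_congr rfl fun i hi => ?_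
      have hia : i ≠ a := fun h => ha (h ▸ hi)
      rw [Finset.erase_insert_of_ne hia.symm, Finset.prod_insert (by simp [ha]), mul_assoc]
  simp_rw [hD, Finset.smul_sum]
  rw [Finset.sum_comm]
  refine Finset.sum_eq_zero fun i hi => ?_
  have hi₀ : i ≠ i₀ := (Finset.mem_erase.1 hi).1
  -- The terms for `σ` and `σ * swap i₀ i` differ by the order of two derivatives and by the sign.
  refine Finset.sum_involution (fun σ _ => σ * Equiv.swap i₀ i) ?_ ?_ ?_ ?_
  · intro σ _
    have h1 : ∏ l ∈ (Finset.univ.erase i₀).erase i, L l ((σ * Equiv.swap i₀ i) l) =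
        ∏ l ∈ (Finset.univ.erase i₀).erase i, L l (σ l) := by
      refine Finset.prod_congr rfl fun l hl => ?_
      simp only [Finset.mem_erase] at hl
      rw [Equiv.Perm.mul_apply, Equiv.swap_apply_of_ne_of_ne hl.2.1 hl.1]
    rw [h1, Equiv.Perm.sign_mul, Equiv.Perm.sign_swap hi₀.symm]
    simp only [Equiv.Perm.mul_apply, Equiv.swap_apply_left, Equiv.swap_apply_right]
    rw [hL i (σ i) (σ i₀)]
    simp
  · intro σ _ _ h
    have := congrArg (fun τ : Equiv.Perm ι => τ i₀) h
    simp only [Equiv.Perm.mul_apply, Equiv.swap_apply_left] at this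
    exact hi₀ (σ.injective this)
  · intro σ _
    exact Finset.mem_univ _
  · intro σ _
    rw [mul_assoc, Equiv.swap_mul_self, mul_one]

/-- If `ε` is a functional that kills all derivatives, then it kills `f₁^{k₁} ⋯ fₙ^{kₙ}` times the
log Jacobian of the `fᵢ` whenever `k ≠ 0`: up to the factor `k_{i₀}`, this product is the
divergence of `f₁^{k₁} ⋯ fₙ^{kₙ}` times a row of cofactors. -/
theorem zsmul_map_monomial_mul_det_eq_zero {A : Type*} [AddCommGroup A] (ε : F →+ A)
    (D : ι → FieldDerivation F) (hε : ∀ j x, ε (D j x) = 0)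
    (hc : ∀ j j' x, D j (D j' x) = D j' (D j x))
    (f : ι → F) (hf : ∀ i, f i ≠ 0) (k : ι → ℤ) (i₀ : ι) :
    k i₀ • ε ((∏ i, f i ^ k i) * (logJacobianMatrix D f).det) = 0 := by
  set L := logJacobianMatrix D f with hLdef
  set G := ∏ i, f i ^ k i with hG
  have hG0 : G ≠ 0 := Finset.prod_ne_zero_iff.2 fun i _ => zpow_ne_zero _ (hf i)
  have hDG : ∀ j, D j G = G * ∑ i, (k i : F) * L i j := by
    intro j
    rw [deriv_eq_mul_logDer _ hG0, hG, logDer_prod _ _ _ fun i _ => zpow_ne_zero _ (hf i)]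
    congr 1
    exact Finset.sum_congr rfl fun i _ => logDer_zpow _ (hf i) _
  -- The row of the `D j G` is `G` times the combination of the rows of `L` with coefficients `k`.
  have h1 : (L.updateRow i₀ fun j => D j G).det = (k i₀ : F) * (G * L.det) := by
    have : (fun j => D j G) = ∑ i, (G * (k i : F)) • L i := by
      funext j
      rw [hDG, Finset.mul_sum, Finset.sum_apply]
      exact Finset.sum_congr rfl fun i _ => by simp [mul_assoc]
    rw [this, Matrix.det_updateRow_sum, smul_eq_mul]
    ring
  -- Expanded along that row, the same determinant is a divergence.
  have h2 : (L.updateRow i₀ fun j => D j G).det = ∑ σ : Equiv.Perm ι,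
      (Equiv.Perm.sign σ : ℤ) • D (σ i₀) (G * ∏ i ∈ Finset.univ.erase i₀, L i (σ i)) := by
    have hzero := sum_sign_mul_deriv_prod_eq_zero D L
      (fun i j j' => logDer_comm (hc j j') (f i)) i₀
    rw [← Matrix.det_transpose, Matrix.det_apply]
    have : ∀ σ : Equiv.Perm ι,
        Equiv.Perm.sign σ • ∏ i, (L.updateRow i₀ fun j => D j G).transpose (σ i) i =
        (Equiv.Perm.sign σ : ℤ) • D (σ i₀) (G * ∏ i ∈ Finset.univ.erase i₀, L i (σ i)) -
        G * ((Equiv.Perm.sign σ : ℤ) •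
          D (σ i₀) (∏ i ∈ Finset.univ.erase i₀, L i (σ i))) := by
      intro σ
      rw [← Finset.mul_prod_erase _ _ (Finset.mem_univ i₀)]
      have : ∏ i ∈ Finset.univ.erase i₀,
          (L.updateRow i₀ fun j => D j G).transpose (σ i) i =
          ∏ i ∈ Finset.univ.erase i₀, L i (σ i) := by
        refine Finset.prod_congr rfl fun i hi => ?_
        rw [Matrix.transpose_apply, Matrix.updateRow_ne (Finset.mem_erase.1 hi).1]
      rw [this, Matrix.transpose_apply, Matrix.updateRow_self, Derivation.leibniz,
        Units.smul_def]
      simp only [smul_eq_mul, zsmul_eq_mul]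
      ring
    rw [Finset.sum_congr rfl fun σ _ => this σ, Finset.sum_sub_distrib, ← Finset.mul_sum, hzero,
      mul_zero, sub_zero]
  rw [← map_zsmul, zsmul_eq_mul, ← h1, h2, map_sum]
  exact Finset.sum_eq_zero fun σ _ => by rw [map_zsmul, hε, smul_zero]

end Residue

/-! ### Two determinants -/

section Determinants

lemma choose_two_succ (N : ℕ) :
    ((N + 1).choose 2 : ℤ) = N + N.choose 2 := by
  rw [Nat.choose_succ_succ' N 1]
  simp

lemma sum_fin_val_eq_choose (n : ℕ) : ∑ i : Fin n, (i : ℕ) = n.choose 2 := by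
  rw [Fin.sum_univ_eq_sum_range fun i => i, Finset.sum_range_id, Nat.choose_two_right]

/-- The exponents of the initial terms of the `u_i^{(r)}`: an off-diagonal entry `(i, j)` is the
number of indices `k > j` different from `i`. -/
def dysonExpMatrix (n : ℕ) (r : ℤ) : Matrix (Fin n) (Fin n) ℤ :=
  Matrix.of fun i j => if i = j then r else (n - 1 - (j : ℤ)) - if j < i then 1 else 0

/-- In the basis of the vectors `e₀ + ⋯ + e_m` the matrix is lower triangular. -/
theorem det_dysonExpMatrix (N : ℕ) (r : ℤ) :
    (dysonExpMatrix (N + 1) r).det =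
      (∏ i ∈ Finset.range N, (r - (i : ℤ))) * (r + (N.choose 2 : ℤ)) := by
  set W : Matrix (Fin (N + 1)) (Fin (N + 1)) ℤ := Matrix.of fun j m => if j ≤ m then 1 else 0
    with hW
  set c : Fin (N + 1) → ℤ := fun m => ∑ j ∈ Finset.Iic m, ((N : ℤ) - j) - (m + 1) with hc
  set T : Matrix (Fin (N + 1)) (Fin (N + 1)) ℤ := Matrix.of fun a m =>
    (if a = m then r - N + m + 1 else 0) + if a = Fin.last N then c m else 0 with hT
  have hIic : ∀ m : Fin (N + 1), (Finset.univ.filter fun j => j ≤ m) = Finset.Iic m := by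
    intro m; ext j; simp
  have hmul : dysonExpMatrix (N + 1) r * W = W * T := by
    ext i m
    have h1 : (dysonExpMatrix (N + 1) r * W) i m =
        c m + if i ≤ m then r - N + m + 1 else 0 := by
      have e1 : ∀ j : Fin (N + 1), dysonExpMatrix (N + 1) r i j * W j m = if j ≤ m then
          ((N : ℤ) - j) - (if j < i then 1 else 0) + (if i = j then r - N + i else 0)
          else 0 := by
        intro j
        simp only [dysonExpMatrix, hW, Matrix.of_apply, mul_ite, mul_one, mul_zero]
        rcases eq_or_ne i j with rfl | hij
        · simp
        · simp [hij]
      have e2 : (∑ j ∈ Finset.Iic m, if j < i then (1 : ℤ) else 0) =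
          if i ≤ m then (i : ℤ) else m + 1 := by
        rw [← Finset.sum_filter, Finset.sum_const, nsmul_eq_mul, mul_one]
        split_ifs with h
        · have : (Finset.Iic m).filter (fun j => j < i) = Finset.Iio i := by
            ext j; simp only [Finset.mem_filter, Finset.mem_Iic, Finset.mem_Iio]
            exact ⟨fun h => h.2, fun h' => ⟨(h'.trans_le h).le, h'⟩⟩
          rw [this, Fin.card_Iio]
        · have : (Finset.Iic m).filter (fun j => j < i) = Finset.Iic m := by
            ext j; simp only [Finset.mem_filter, Finset.mem_Iic]
            exact ⟨fun h => h.1, fun h' => ⟨h', h'.trans_lt (not_le.1 h)⟩⟩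
          rw [this, Fin.card_Iic]
          push_cast; ring
      rw [Matrix.mul_apply, Finset.sum_congr rfl fun j _ => e1 j, ← Finset.sum_filter, hIic,
        Finset.sum_add_distrib, Finset.sum_sub_distrib, e2, Finset.sum_ite_eq, hc]
      simp only [Finset.mem_Iic]
      split_ifs <;> ring
    have h2 : (W * T) i m = c m + if i ≤ m then r - N + m + 1 else 0 := by
      simp only [Matrix.mul_apply, hW, hT, Matrix.of_apply, mul_add, Finset.sum_add_distrib]
      simp [Fin.le_last, add_comm]
    rw [h1, h2]
  have hWdet : W.det = 1 := by
    rw [Matrix.det_of_isUpperTriangular]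
    · simp [hW]
    · intro i j hij
      simpa [hW] using hij
  have hTdet : T.det = ∏ m, T m m := by
    refine Matrix.det_of_isLowerTriangular _ fun i j hij => ?_
    have hij' : i < j := hij
    simp [hT, hij'.ne, (hij'.trans_le (Fin.le_last j)).ne]
  have hdet := congrArg Matrix.det hmul
  rw [Matrix.det_mul, Matrix.det_mul, hWdet, mul_one, one_mul] at hdet
  rw [hdet, hTdet, Fin.prod_univ_castSucc]
  congr 1
  · rw [← Finset.prod_range_reflect, ← Fin.prod_univ_eq_prod_range]
    refine Finset.prod_congr rfl fun m _ => ?_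
    have hm := m.2
    have : ((N - 1 - (m : ℕ) : ℕ) : ℤ) = N - 1 - m := by omega
    simp only [hT, Matrix.of_apply, if_true, (Fin.castSucc_lt_last m).ne, if_false,
      Fin.val_castSucc, this]
    ring
  · have hlast : Finset.Iic (Fin.last N) = Finset.univ := by
      ext j; simp [Fin.le_last]
    have hsum : ((∑ j : Fin (N + 1), (j : ℕ) : ℕ) : ℤ) = (N + 1).choose 2 := by
      rw [sum_fin_val_eq_choose]
    push_cast at hsum
    rw [choose_two_succ] at hsum
    have h2 : (2 : ℤ) * (N + N.choose 2) = (N + 1) * N := by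
      have h := Finset.sum_range_id_mul_two (N + 1)
      rw [Finset.sum_range_id, ← Nat.choose_two_right] at h
      have h' : (((N + 1).choose 2 : ℕ) : ℤ) * 2 = (N + 1) * N := by
        exact_mod_cast h
      rw [choose_two_succ] at h'
      linarith
    simp only [hT, hc, Matrix.of_apply, if_true, hlast, Finset.sum_sub_distrib, hsum,
      Finset.sum_const, Finset.card_univ, Fintype.card_fin, Fin.val_last, nsmul_eq_mul]
    push_cast
    linarith

/-- A sum over ordered pairs of distinct indices, as a sum over increasing pairs. -/
lemma sum_sum_eq_sum_lt {n : ℕ} {M : Type*} [AddCommMonoid M] (h : Fin n → Fin n → M)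
    (hd : ∀ a, h a a = 0) (P : Fin n → Prop) [DecidablePred P] :
    ∑ p : Fin n × Fin n with p.1 < p.2 ∧ P p.1 ∧ P p.2, (h p.1 p.2 + h p.2 p.1) =
      ∑ a with P a, ∑ b with P b, h a b := by
  have hswap : ∑ p : Fin n × Fin n with p.1 < p.2 ∧ P p.1 ∧ P p.2, h p.2 p.1 =
      ∑ p : Fin n × Fin n with p.2 < p.1 ∧ P p.1 ∧ P p.2, h p.1 p.2 := by
    refine Finset.sum_equiv (Equiv.prodComm _ _) ?_ ?_
    · intro p
      simp [and_comm]
    · intro p _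
      rfl
  rw [Finset.sum_add_distrib, hswap, ← Finset.sum_product', ← Finset.sum_union]
  · refine Finset.sum_subset ?_ ?_
    · intro p
      simp only [Finset.mem_union, Finset.mem_filter, Finset.mem_univ, true_and,
        Finset.mem_product]
      tauto
    · intro p hp hp'
      simp only [Finset.mem_union, Finset.mem_filter, Finset.mem_univ, true_and,
        Finset.mem_product] at hp hp'
      have : p.1 = p.2 := by
        rcases lt_trichotomy p.1 p.2 with h | h | h
        · exact absurd (Or.inl ⟨h, hp⟩) hp'
        · exact h
        · exact absurd (Or.inr ⟨h, hp⟩) hp'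
      rw [this, hd]
  · rw [Finset.disjoint_left]
    intro p hp hp'
    simp only [Finset.mem_filter, Finset.mem_univ, true_and] at hp hp'
    exact lt_asymm hp.1 hp'.1

variable {F : Type*} [Field F]

/-- The logarithmic derivatives of the `u_i^{(r)}`, as rational functions of the variables. The
summand with `k = j` is `x_j / 0 = 0`. -/
def dysonLogMatrix {n : ℕ} (r : ℤ) (x : Fin n → F) : Matrix (Fin n) (Fin n) F :=
  Matrix.of fun i j => if i = j then (r : F) else ∑ k with k ≠ i, x j / (x j - x k)

lemma card_filter_fst_lt_snd (n : ℕ) :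
    (Finset.univ.filter fun p : Fin n × Fin n => p.1 < p.2).card = n.choose 2 := by
  rw [← sum_fin_val_eq_choose, Finset.card_filter, Fintype.sum_prod_type_right]
  refine Finset.sum_congr rfl fun j _ => ?_
  rw [← Finset.card_filter]
  have : (Finset.univ.filter fun i => i < j) = Finset.Iio j := by ext; simp
  rw [this, Fin.card_Iio]

/-- The two terms of an unordered pair add up to `1`, so the sum counts pairs. -/
lemma sum_sum_div_sub_eq_choose {n : ℕ} (x : Fin n → F) (hx : Function.Injective x) :
    ∑ a, ∑ b, x a / (x a - x b) = (n.choose 2 : F) := by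
  have h := sum_sum_eq_sum_lt (fun a b => x a / (x a - x b)) (fun a => by simp) fun _ => True
  simp only [and_true, Finset.filter_true] at h
  rw [← h, ← card_filter_fst_lt_snd, Finset.card_eq_sum_ones, Nat.cast_sum]
  refine Finset.sum_congr rfl fun p hp => ?_
  have hne : x p.1 - x p.2 ≠ 0 :=
    sub_ne_zero.2 fun e => (Finset.mem_filter.1 hp).2.ne (hx e)
  have hne' : x p.2 - x p.1 ≠ 0 := fun e => hne (by linear_combination -e)
  field_simp
  ring

/-- The vectors `(x_j^m)_j` triangularize the matrix: applied to such a vector, the poles combine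
to the divided differences `(x_i^{m+1} - x_j^{m+1}) / (x_i - x_j)`, which are polynomials. -/
theorem det_dysonLogMatrix (N : ℕ) (r : ℤ) (x : Fin (N + 1) → F) (hx : Function.Injective x) :
    (dysonLogMatrix r x).det =
      (((∏ i ∈ Finset.range N, (r - (i : ℤ))) * (r + (N.choose 2 : ℤ)) : ℤ) : F) := by
  set V := Matrix.vandermonde x with hV
  set h : ℕ → Fin (N + 1) → Fin (N + 1) → F := fun m a b => x a ^ (m + 1) / (x a - x b) with hh
  set Q : ℕ → F := fun m => ∑ a, ∑ b, h m a b with hQ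
  set p : ℕ → F := fun m => ∑ j, x j ^ m with hp
  set T : Matrix (Fin (N + 1)) (Fin (N + 1)) F := Matrix.of fun a m =>
    (if a = m then (r : F) + m + 1 else 0) + (if a = 0 then Q m else 0) -
      if a ≤ m then p (m - a) else 0 with hT
  have hdd : ∀ (m : ℕ) (i b : Fin (N + 1)), b ≠ i →
      h m i b + h m b i = ∑ a ∈ Finset.range (m + 1), x i ^ a * x b ^ (m - a) := by
    intro m i b hb
    have hne : x i - x b ≠ 0 := sub_ne_zero.2 fun e => hb (hx e).symm
    have hne' : x b - x i ≠ 0 := fun e => hne (by linear_combination -e)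
    have key := (Commute.all (x i) (x b)).geom_sum₂_mul (m + 1)
    simp only [Nat.add_sub_cancel] at key
    rw [hh]
    field_simp
    linear_combination (x i - x b) * key
  have hself : ∀ (m : ℕ) (i : Fin (N + 1)), h m i i = 0 := by
    intro m i; simp [hh]
  have hmul : dysonLogMatrix r x * V = V * T := by
    ext i m
    have h1 : (dysonLogMatrix r x * V) i m = (r : F) * x i ^ (m : ℕ) +
        ∑ j with j ≠ i, ∑ k with k ≠ i, h m j k := by
      rw [Matrix.mul_apply, ← Finset.add_sum_erase _ _ (Finset.mem_univ i)]
      congr 1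
      · simp [dysonLogMatrix, hV, Matrix.vandermonde_apply]
      · refine Finset.sum_congr (by ext; simp) fun j hj => ?_
        have hj' : i ≠ j := (Finset.mem_filter.1 hj).2.symm
        simp only [dysonLogMatrix, hV, Matrix.vandermonde_apply, Matrix.of_apply, if_neg hj',
          Finset.sum_mul, hh]
        refine Finset.sum_congr rfl fun k _ => ?_
        ring
    -- Removing row and column `i` from the double sum `Q m` leaves divided differences at `x_i`.
    have h2 : ∑ j with j ≠ i, ∑ k with k ≠ i, h m j k =
        Q m - ∑ b with b ≠ i, (h m i b + h m b i) := by
      have e : ∀ g : Fin (N + 1) → F, ∑ k with k ≠ i, g k = ∑ k, g k - g i := by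
        intro g
        rw [← Finset.add_sum_erase Finset.univ g (Finset.mem_univ i), add_sub_cancel_left]
        exact Finset.sum_congr (by ext; simp) fun _ _ => rfl
      simp only [e, Finset.sum_sub_distrib, Finset.sum_add_distrib, hself, hQ]
      ring
    have h3 : ∑ b with b ≠ i, (h m i b + h m b i) =
        ∑ a ∈ Finset.range ((m : ℕ) + 1), x i ^ a * p (m - a) - (m + 1) * x i ^ (m : ℕ) := by
      have e1 : ∑ b with b ≠ i, (h m i b + h m b i) =
          ∑ b with b ≠ i, ∑ a ∈ Finset.range ((m : ℕ) + 1), x i ^ a * x b ^ ((m : ℕ) - a) :=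
        Finset.sum_congr rfl fun b hb => hdd m i b (Finset.mem_filter.1 hb).2
      have e2 : ∑ b, ∑ a ∈ Finset.range ((m : ℕ) + 1), x i ^ a * x b ^ ((m : ℕ) - a) =
          ∑ a ∈ Finset.range ((m : ℕ) + 1), x i ^ a * p (m - a) := by
        rw [Finset.sum_comm]
        simp only [hp, Finset.mul_sum]
      have e3 : ∑ a ∈ Finset.range ((m : ℕ) + 1), x i ^ a * x i ^ ((m : ℕ) - a) =
          (m + 1) * x i ^ (m : ℕ) := by
        rw [Finset.sum_congr rfl fun a ha => ?_, Finset.sum_const, Finset.card_range,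
          nsmul_eq_mul]
        · push_cast; rfl
        · rw [← pow_add, Nat.add_sub_cancel' (Nat.lt_succ_iff.1 (Finset.mem_range.1 ha))]
      rw [e1, ← e2, ← e3, ← Finset.add_sum_erase Finset.univ _ (Finset.mem_univ i),
        add_sub_cancel_left]
      exact Finset.sum_congr (by ext; simp) fun _ _ => rfl
    have h4 : (V * T) i m = ((r : F) + m + 1) * x i ^ (m : ℕ) + Q m -
        ∑ a ∈ Finset.range ((m : ℕ) + 1), x i ^ a * p (m - a) := by
      have e1 : ∑ a : Fin (N + 1), (x i ^ (a : ℕ) * if a ≤ m then p (m - a) else 0) =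
          ∑ a ∈ Finset.range ((m : ℕ) + 1), x i ^ a * p (m - a) := by
        have := Fin.sum_univ_eq_sum_range
          (fun a => x i ^ a * if a ≤ (m : ℕ) then p (m - a) else 0) (N + 1)
        simp only [Fin.le_def]
        rw [this]
        have hsub : Finset.range ((m : ℕ) + 1) ⊆ Finset.range (N + 1) :=
          Finset.range_subset_range.2 m.2
        rw [← Finset.sum_subset hsub]
        · refine Finset.sum_congr rfl fun a ha => ?_
          rw [if_pos (Nat.lt_succ_iff.1 (Finset.mem_range.1 ha))]
        · intro a _ ha
          rw [if_neg, mul_zero]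
          simpa [Nat.lt_succ_iff] using ha
      simp only [Matrix.mul_apply, hV, Matrix.vandermonde_apply, hT, Matrix.of_apply, mul_sub,
        mul_add, Finset.sum_sub_distrib, Finset.sum_add_distrib, e1]
      simp
      ring
    rw [h1, h2, h3, h4]
    ring
  have hVdet : V.det ≠ 0 := Matrix.det_vandermonde_ne_zero_iff.2 hx
  have hTdet : T.det = ∏ m, T m m := by
    refine Matrix.det_of_isUpperTriangular fun i j hij => ?_
    have hij' : j < i := hij
    simp [hT, hij'.ne', (hij'.trans_le' (Fin.zero_le j)).ne', not_le.2 hij']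
  have hdet := congrArg Matrix.det hmul
  rw [Matrix.det_mul, Matrix.det_mul, mul_comm] at hdet
  rw [mul_left_cancel₀ hVdet hdet, hTdet, Fin.prod_univ_succ, mul_comm, Int.cast_mul]
  have hp0 : p 0 = N + 1 := by simp [hp]
  congr 1
  · rw [← Finset.prod_range_reflect, ← Fin.prod_univ_eq_prod_range
      (fun j => (r - ((N - 1 - j : ℕ) : ℤ))), Int.cast_prod]
    refine Finset.prod_congr rfl fun m _ => ?_
    have hm := m.2
    have : ((N - 1 - (m : ℕ) : ℕ) : ℤ) = N - 1 - m := by omega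
    simp only [hT, Matrix.of_apply, if_true, Fin.succ_ne_zero, if_false, this, le_refl,
      Nat.sub_self, hp0, Fin.val_succ]
    push_cast
    ring
  · have hQ0 : Q 0 = ((N + 1).choose 2 : F) := by
      rw [← sum_sum_div_sub_eq_choose x hx]
      simp [hQ, hh]
    have hc : (((N + 1).choose 2 : ℕ) : F) = N + (N.choose 2 : F) := by
      exact_mod_cast congrArg (Int.cast : ℤ → F) (choose_two_succ N)
    simp only [hT, Matrix.of_apply, if_true, le_refl, Nat.sub_self, hp0, Fin.val_zero, hQ0, hc]
    push_cast
    ring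

end Determinants

variable {n : ℕ} {K : Type*} [Field K]

/-! ### The derivations `z_j ∂/∂z_j` -/

section Euler

/-- The termwise operator `z_j ∂/∂z_j`, which multiplies the coefficient of `z^m` by `m_j`. -/
def eulerFun (j : Fin n) (η : MNSeries n K) : MNSeries n K where
  coeff m := (m.coord j : K) * η.coeff m
  isPWO_support' := η.isPWO_support.mono fun _ hm => right_ne_zero_of_mul hm

lemma coord_add (a b : ExpGroup n) (j : Fin n) : (a + b).coord j = a.coord j + b.coord j := rfl

lemma coord_zero (j : Fin n) : (0 : ExpGroup n).coord j = 0 := rfl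

lemma coord_basis (i j : Fin n) : (ExpGroup.basis i).coord j = if i = j then 1 else 0 := by
  simp [ExpGroup.coord, ExpGroup.basis, Pi.single_apply, eq_comm]

lemma coord_zsmul (k : ℤ) (a : ExpGroup n) (j : Fin n) : (k • a).coord j = k * a.coord j := by
  change (k • ofLex a) (OrderDual.toDual j) = _
  rw [Pi.smul_apply, smul_eq_mul]
  rfl

lemma coord_sum {ι : Type*} (s : Finset ι) (f : ι → ExpGroup n) (j : Fin n) :
    (∑ i ∈ s, f i).coord j = ∑ i ∈ s, (f i).coord j := by
  classical
  induction s using Finset.induction_on with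
  | empty => rfl
  | insert a s ha ih => rw [Finset.sum_insert ha, Finset.sum_insert ha, coord_add, ih]

lemma eulerFun_mul (j : Fin n) (x y : MNSeries n K) :
    eulerFun j (x * y) = x * eulerFun j y + y * eulerFun j x := by
  have hsx : (eulerFun j x).support ⊆ x.support := fun _ hm => right_ne_zero_of_mul hm
  have hsy : (eulerFun j y).support ⊆ y.support := fun _ hm => right_ne_zero_of_mul hm
  ext m
  rw [HahnSeries.coeff_add, mul_comm y, HahnSeries.coeff_mul_left' x.isPWO_support hsx,
    HahnSeries.coeff_mul_right' y.isPWO_support hsy, ← Finset.sum_add_distrib]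
  change (m.coord j : K) * (x * y).coeff m = _
  rw [HahnSeries.coeff_mul, Finset.mul_sum]
  refine Finset.sum_congr rfl fun p hp => ?_
  have hm : p.1 + p.2 = m := by simpa using (Finset.mem_antidiagonal.1 hp).2.2
  rw [← hm, coord_add, Int.cast_add]
  change _ = x.coeff p.1 * ((p.2.coord j : K) * y.coeff p.2) +
    (p.1.coord j : K) * x.coeff p.1 * y.coeff p.2
  ring

/-- The derivation `z_j ∂/∂z_j`. -/
def euler (K : Type*) [Field K] (j : Fin n) :
    FieldDerivation (MNSeries n K) :=
  Derivation.mk' (AddMonoidHom.toIntLinearMap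
    { toFun := eulerFun j
      map_zero' := by ext m; exact mul_zero _
      map_add' := fun x y => by ext m; exact mul_add _ _ _ })
    fun x y => eulerFun_mul j x y

lemma coeff_euler (j : Fin n) (η : MNSeries n K) (m : ExpGroup n) :
    (euler K j η).coeff m = (m.coord j : K) * η.coeff m := rfl

lemma euler_comm (i j : Fin n) (η : MNSeries n K) :
    euler K i (euler K j η) = euler K j (euler K i η) := by
  ext m
  simp only [coeff_euler]
  ring

lemma constTerm_euler (j : Fin n) (η : MNSeries n K) : (euler K j η).coeff 0 = 0 := by
  simp [coeff_euler, coord_zero]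

lemma var_mul_pderiv (j : Fin n) (η : MNSeries n K) : var K j * pderiv j η = euler K j η := by
  ext m
  rw [var, HahnSeries.coeff_single_mul, one_mul, coeff_euler]
  change (((m - ExpGroup.basis j).coord j + 1 : ℤ) : K) *
    η.coeff (m - ExpGroup.basis j + ExpGroup.basis j) = _
  rw [sub_add_cancel]
  have h := coord_add (m - ExpGroup.basis j) (ExpGroup.basis j) j
  rw [sub_add_cancel, coord_basis, if_pos rfl] at h
  rw [← h]

lemma euler_var (i j : Fin n) : euler K j (var K i) = if i = j then var K i else 0 := by
  ext m
  rw [coeff_euler, var, HahnSeries.coeff_single]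
  by_cases hm : m = ExpGroup.basis i
  · subst hm
    by_cases hij : i = j <;> simp [coord_basis, hij]
  · have h0 : (HahnSeries.single (ExpGroup.basis i) (1 : K)).coeff m = 0 :=
      HahnSeries.coeff_single_of_ne hm
    rw [if_neg hm, mul_zero]
    split_ifs
    · exact h0.symm
    · rfl

/-- The factors `z_j` and `1 / F_i` turn the Jacobian determinant into the determinant of the
logarithmic derivatives. -/
lemma logJacobian_eq_det (F : Fin n → MNSeries n K) :
    logJacobian F = (logJacobianMatrix (fun j => euler K j) F).det := by
  have h : logJacobianMatrix (fun j => euler K j) F = Matrix.of fun i j =>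
      (F i)⁻¹ * (Matrix.of fun i j => var K j * (Matrix.of fun i j => pderiv j (F i)) i j) i j := by
    ext1 i j
    simp only [logJacobianMatrix, logDer, Matrix.of_apply, var_mul_pderiv]
    rw [div_eq_mul_inv, mul_comm]
  rw [h, Matrix.det_mul_column, Matrix.det_mul_row, logJacobian, Finset.prod_inv_distrib]
  ring

end Euler

/-! ### Initial exponents and supports -/

section Supports

/-- The exponents of `f` lie in `a + S` and those of `f⁻¹` in `-a + S`. When all elements of `S` are
nonnegative, `a` is the initial exponent of `f`. -/
structure HasInitial (S : AddSubmonoid (ExpGroup n)) (f : MNSeries n K) (a : ExpGroup n) :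
    Prop where
  ne_zero : f ≠ 0
  sub_mem : ∀ m ∈ f.support, m - a ∈ S
  inv_add_mem : ∀ m ∈ f⁻¹.support, m + a ∈ S

variable {S : AddSubmonoid (ExpGroup n)} {f g : MNSeries n K} {a b : ExpGroup n}

lemma exists_add_eq_of_mem_support_mul {m : ExpGroup n} (hm : m ∈ (f * g).support) :
    ∃ p ∈ f.support, ∃ q ∈ g.support, p + q = m :=
  Set.mem_add.1 (HahnSeries.support_mul_subset hm)

lemma HasInitial.mul (hf : HasInitial S f a) (hg : HasInitial S g b) :
    HasInitial S (f * g) (a + b) where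
  ne_zero := mul_ne_zero hf.ne_zero hg.ne_zero
  sub_mem m hm := by
    obtain ⟨p, hp, q, hq, rfl⟩ := exists_add_eq_of_mem_support_mul hm
    have := S.add_mem (hf.sub_mem p hp) (hg.sub_mem q hq)
    rwa [sub_add_sub_comm] at this
  inv_add_mem m hm := by
    rw [mul_inv] at hm
    obtain ⟨p, hp, q, hq, rfl⟩ := exists_add_eq_of_mem_support_mul hm
    have := S.add_mem (hf.inv_add_mem p hp) (hg.inv_add_mem q hq)
    rwa [add_add_add_comm] at this

lemma HasInitial.inv (hf : HasInitial S f a) : HasInitial S f⁻¹ (-a) where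
  ne_zero := inv_ne_zero hf.ne_zero
  sub_mem m hm := by simpa using hf.inv_add_mem m hm
  inv_add_mem m hm := by
    rw [inv_inv] at hm
    simpa [sub_eq_add_neg] using hf.sub_mem m hm

lemma HasInitial.neg (hf : HasInitial S f a) : HasInitial S (-f) a where
  ne_zero := neg_ne_zero.2 hf.ne_zero
  sub_mem m hm := hf.sub_mem m (by rwa [HahnSeries.support_neg] at hm)
  inv_add_mem m hm := hf.inv_add_mem m (by
    have h : (-f)⁻¹ = -f⁻¹ := inv_neg
    rwa [h, HahnSeries.support_neg] at hm)

lemma hasInitial_single (S : AddSubmonoid (ExpGroup n)) (a : ExpGroup n) :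
    HasInitial S (HahnSeries.single a (1 : K)) a where
  ne_zero := HahnSeries.single_ne_zero one_ne_zero
  sub_mem m hm := by
    rw [HahnSeries.eq_of_mem_support_single hm, sub_self]
    exact S.zero_mem
  inv_add_mem m hm := by
    have : (HahnSeries.single a (1 : K))⁻¹ = HahnSeries.single (-a) 1 := by
      refine inv_eq_of_mul_eq_one_right ?_
      rw [HahnSeries.single_mul_single, add_neg_cancel, one_mul]
      rfl
    rw [this] at hm
    rw [HahnSeries.eq_of_mem_support_single hm, neg_add_cancel]
    exact S.zero_mem

lemma hasInitial_one (S : AddSubmonoid (ExpGroup n)) : HasInitial S (1 : MNSeries n K) 0 :=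
  hasInitial_single S 0

lemma HasInitial.pow (hf : HasInitial S f a) (k : ℕ) : HasInitial S (f ^ k) (k • a) := by
  induction k with
  | zero => simpa using hasInitial_one S
  | succ k ih =>
    rw [pow_succ, succ_nsmul]
    exact ih.mul hf

lemma HasInitial.zpow (hf : HasInitial S f a) (k : ℤ) : HasInitial S (f ^ k) (k • a) := by
  cases k with
  | ofNat k => simpa using hf.pow k
  | negSucc k =>
    rw [zpow_negSucc, negSucc_zsmul]
    exact (hf.pow _).inv

lemma HasInitial.prod {ι : Type*} (s : Finset ι) {f : ι → MNSeries n K} {a : ι → ExpGroup n}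
    (h : ∀ i ∈ s, HasInitial S (f i) (a i)) : HasInitial S (∏ i ∈ s, f i) (∑ i ∈ s, a i) := by
  classical
  induction s using Finset.induction_on with
  | empty => simpa using hasInitial_one S
  | insert i s hi ih =>
    rw [Finset.prod_insert hi, Finset.sum_insert hi]
    exact (h i (by simp)).mul (ih fun j hj => h j (by simp [hj]))

/-- The support of `1 / (1 - z^e)` lies in every monoid containing `e > 0`: a smallest exponent `m`
outside the monoid would come with the smaller exponent `m - e`. -/
lemma hasInitial_one_sub_single {e : ExpGroup n} (he : 0 < e) (heS : e ∈ S) :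
    HasInitial S (1 - HahnSeries.single e (1 : K)) 0 := by
  have hne : (1 : MNSeries n K) - HahnSeries.single e (1 : K) ≠ 0 := by
    intro h
    have := congrArg (fun x : MNSeries n K => x.coeff 0) h
    simp [HahnSeries.coeff_one, he.ne] at this
  refine ⟨hne, fun m hm => ?_, fun m hm => ?_⟩
  · rw [sub_zero]
    rcases HahnSeries.support_sub_subset _ _ hm with h | h
    · rw [HahnSeries.support_one, Set.mem_singleton_iff] at h
      exact h ▸ S.zero_mem
    · rw [HahnSeries.eq_of_mem_support_single h]
      exact heS
  · rw [add_zero]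
    set y := (1 - HahnSeries.single e (1 : K))⁻¹ with hy
    have hrec : ∀ m, y.coeff m = (if m = 0 then 1 else 0) + y.coeff (m - e) := by
      intro m
      have h : y = 1 + HahnSeries.single e 1 * y := by
        have := mul_inv_cancel₀ hne
        rw [← hy] at this
        linear_combination this
      conv_lhs => rw [h]
      rw [HahnSeries.coeff_add, HahnSeries.coeff_one, HahnSeries.coeff_single_mul, one_mul]
      congr
    refine y.isWF_support.induction (P := fun m => m ∈ S) hm fun m hm ih => ?_
    have h := hrec m
    by_cases hm0 : m = 0
    · exact hm0 ▸ S.zero_mem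
    · rw [if_neg hm0, zero_add] at h
      have := ih (m - e) (by rw [HahnSeries.mem_support, ← h]; exact hm) (sub_lt_self m he)
      simpa using S.add_mem this heS

lemma HasInitial.order_eq (hS : ∀ s ∈ S, 0 ≤ s) (hf : HasInitial S f a) : f.order = a := by
  have hf0 := hf.ne_zero
  have h1 := hS _ (hf.sub_mem f.order fun h => hf0 (HahnSeries.coeff_order_eq_zero.1 h))
  have h2 := hS _ (hf.inv_add_mem f⁻¹.order fun h =>
    inv_ne_zero hf0 (HahnSeries.coeff_order_eq_zero.1 h))
  have h3 : f.order + f⁻¹.order = 0 := by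
    rw [← HahnSeries.order_mul hf0 (inv_ne_zero hf0), mul_inv_cancel₀ hf0, HahnSeries.order_one]
  have h4 : f⁻¹.order = -f.order := (neg_eq_of_add_eq_zero_right h3).symm
  rw [h4, neg_add_eq_sub] at h2
  exact le_antisymm (sub_nonneg.1 h2) (sub_nonneg.1 h1)

/-- Strict convergence of `Φ(F₁, …, Fₙ)`: the exponents of `F^k` lie in `ρ(k) + S`, and the sum of
two well-ordered sets is well-ordered and has finite fibres. -/
theorem exists_hasComp (hSpwo : (S : Set (ExpGroup n)).IsPWO)
    (hS : ∀ s ∈ S, 0 ≤ s) (F : Fin n → MNSeries n K)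
    (hF : ∀ i, ∃ a, HasInitial S (F i) a) (hinj : Function.Injective (initialHom F))
    (Φ : FormalSeries n K) (hΦ : IsInducedMN (initialHom F) Φ) :
    ∃ η, HasComp Φ F η := by
  have hF' : ∀ i, HasInitial S (F i) (F i).order := fun i => by
    obtain ⟨a, ha⟩ := hF i
    rwa [ha.order_eq hS]
  set A : Set (ExpGroup n) := initialHom F '' Function.support Φ with hA
  have hApwo : A.IsPWO := by
    rw [Set.isPWO_iff_isWF]
    exact (Set.wellFoundedOn_image (r := (· < ·))).2 hΦ
  set t : (Fin n → ℤ) → MNSeries n K := fun k => Φ k • ∏ i, F i ^ k i with ht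
  have hsupp : ∀ k, ∀ m ∈ (t k).support, initialHom F k ∈ A ∧ m - initialHom F k ∈ S := by
    intro k m hm
    rw [HahnSeries.mem_support, ht, HahnSeries.coeff_smul, smul_eq_mul] at hm
    refine ⟨⟨k, left_ne_zero_of_mul hm, rfl⟩, ?_⟩
    exact (HasInitial.prod Finset.univ fun i _ => (hF' i).zpow (k i)).sub_mem m
      (right_ne_zero_of_mul hm)
  let s : HahnSeries.SummableFamily (ExpGroup n) K (Fin n → ℤ) :=
    { toFun := t
      isPWO_iUnion_support' := by
        refine (hApwo.add hSpwo).mono ?_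
        refine Set.iUnion_subset fun k m hm => ?_
        obtain ⟨h1, h2⟩ := hsupp k m hm
        exact Set.mem_add.2 ⟨_, h1, _, h2, add_sub_cancel _ _⟩
      finite_co_support' := fun m => by
        refine Set.Finite.of_finite_image (f := fun k => (initialHom F k, m - initialHom F k))
          ((Set.AddAntidiagonal.finite_of_isPWO hApwo hSpwo m).subset ?_) ?_
        · rintro _ ⟨k, hk, rfl⟩
          obtain ⟨h1, h2⟩ := hsupp k m hk
          exact ⟨h1, h2, add_sub_cancel _ _⟩
        · intro k _ l _ hkl
          exact hinj (Prod.ext_iff.1 hkl).1 }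
  exact ⟨s.hsum, fun g => ⟨s.finite_co_support g, rfl⟩⟩

end Supports

/-! ### Initial terms and log Jacobian of the `u_i^{(r)}` -/

section Dyson

lemma basis_lt_basis {a b : Fin n} (h : a < b) :
    ExpGroup.basis a < ExpGroup.basis b := by
  refine ⟨OrderDual.toDual b, fun j hj => ?_, ?_⟩
  · have hj' : b < OrderDual.ofDual j := hj
    have h1 : OrderDual.ofDual j ≠ b := hj'.ne'
    have h2 : OrderDual.ofDual j ≠ a := (h.trans hj').ne'
    change (ExpGroup.basis a).coord (OrderDual.ofDual j) =
      (ExpGroup.basis b).coord (OrderDual.ofDual j)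
    rw [coord_basis, coord_basis, if_neg h1.symm, if_neg h2.symm]
  · change (ExpGroup.basis a).coord b < (ExpGroup.basis b).coord b
    rw [coord_basis, coord_basis, if_pos rfl, if_neg h.ne]
    exact one_pos

/-- The monoid generated by the exponents of the `z_b / z_a` with `a < b`. These ratios have
positive order, and `z_a - z_b = z_a (1 - z_b / z_a)`. -/
def ratioMonoid (n : ℕ) : AddSubmonoid (ExpGroup n) :=
  AddSubmonoid.closure ((fun p : Fin n × Fin n => ExpGroup.basis p.2 - ExpGroup.basis p.1) ''
    {p | p.1 < p.2})

lemma nonneg_of_mem_ratioGenerators {s : ExpGroup n}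
    (hs : s ∈ (fun p : Fin n × Fin n => ExpGroup.basis p.2 - ExpGroup.basis p.1) ''
      {p | p.1 < p.2}) : 0 ≤ s := by
  obtain ⟨p, hp, rfl⟩ := hs
  exact sub_nonneg.2 (basis_lt_basis hp).le

lemma nonneg_of_mem_ratioMonoid {s : ExpGroup n} (hs : s ∈ ratioMonoid n) : 0 ≤ s := by
  induction hs using AddSubmonoid.closure_induction with
  | mem x hx => exact nonneg_of_mem_ratioGenerators hx
  | zero => exact le_rfl
  | add x y _ _ hx hy => exact add_nonneg hx hy

lemma isPWO_ratioMonoid (n : ℕ) : (ratioMonoid n : Set (ExpGroup n)).IsPWO :=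
  Set.IsPWO.addSubmonoid_closure (fun _ => nonneg_of_mem_ratioGenerators)
    (Set.toFinite _).isPWO

lemma var_injective (K : Type*) [Field K] : Function.Injective (var K : Fin n → MNSeries n K) := by
  intro i j h
  by_contra hij
  have := congrArg (fun x : MNSeries n K => x.coeff (ExpGroup.basis i)) h
  simp only [var, HahnSeries.coeff_single_same] at this
  rw [HahnSeries.coeff_single_of_ne] at this
  · exact one_ne_zero this
  · intro e
    have h1 := congrArg (fun m => ExpGroup.coord m i) e
    simp [coord_basis, Ne.symm hij] at h1

lemma var_ne_zero (j : Fin n) : var K j ≠ 0 := HahnSeries.single_ne_zero one_ne_zero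

lemma hasInitial_var_sub_var {a b : Fin n} (h : a < b) :
    HasInitial (ratioMonoid n) (var K a - var K b) (ExpGroup.basis a) := by
  have h1 : var K a - var K b = var K a *
      (1 - HahnSeries.single (ExpGroup.basis b - ExpGroup.basis a) (1 : K)) := by
    rw [mul_sub, mul_one, var, var, HahnSeries.single_mul_single, add_sub_cancel, one_mul]
  have h2 := (hasInitial_single (K := K) (ratioMonoid n) (ExpGroup.basis a)).mul
    (hasInitial_one_sub_single (K := K) (sub_pos.2 (basis_lt_basis h))
      (AddSubmonoid.subset_closure ⟨(a, b), h, rfl⟩))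
  rw [add_zero] at h2
  rw [h1]
  exact h2

lemma hasInitial_dysonVar (r : ℤ) (i : Fin n) :
    HasInitial (ratioMonoid n) (dysonVar K n r i) (r • ExpGroup.basis i +
      ∑ p : Fin n × Fin n with p.1 < p.2 ∧ p.1 ≠ i ∧ p.2 ≠ i, ExpGroup.basis p.1) := by
  have h := ((hasInitial_single (K := K) (ratioMonoid n) (ExpGroup.basis i)).zpow r).mul
    (HasInitial.prod (K := K)
      (Finset.univ.filter fun p : Fin n × Fin n => p.1 < p.2 ∧ p.1 ≠ i ∧ p.2 ≠ i)
      fun p hp => hasInitial_var_sub_var (Finset.mem_filter.1 hp).2.1)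
  have h1 : HasInitial (ratioMonoid n) ((-1 : MNSeries n K) ^ (i : ℕ)) 0 := by
    simpa using (hasInitial_one (K := K) (ratioMonoid n)).neg.pow (i : ℕ)
  have h2 := h1.mul h
  rwa [zero_add, ← mul_assoc] at h2

lemma dysonVar_ne_zero (r : ℤ) (i : Fin n) : dysonVar K n r i ≠ 0 :=
  (hasInitial_dysonVar r i).ne_zero

/-- The initial term of `z_a - z_b` is `z_a` for `a < b`, so the exponent of `z_j` in the initial
term of `u_i^{(r)}`, for `i ≠ j`, counts the `k > j` different from `i`. -/
lemma expMatrix_dysonVar (r : ℤ) : expMatrix (dysonVar K n r) = dysonExpMatrix n r := by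
  ext i j
  have hsum : ∑ p : Fin n × Fin n with p.1 < p.2 ∧ p.1 ≠ i ∧ p.2 ≠ i,
      (if p.1 = j then (1 : ℤ) else 0) =
      if i = j then 0 else (n - 1 - (j : ℤ)) - if j < i then 1 else 0 := by
    have h := sum_sum_eq_sum_lt (fun a b : Fin n => if a < b ∧ a = j then (1 : ℤ) else 0)
      (fun a => by simp) fun a => a ≠ i
    have e : ∀ p ∈ Finset.univ.filter fun p : Fin n × Fin n => p.1 < p.2 ∧ p.1 ≠ i ∧ p.2 ≠ i,
        ((if p.1 < p.2 ∧ p.1 = j then (1 : ℤ) else 0) +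
          if p.2 < p.1 ∧ p.2 = j then 1 else 0) = if p.1 = j then 1 else 0 := by
      intro p hp
      have hlt := (Finset.mem_filter.1 hp).2.1
      simp [hlt, hlt.not_gt]
    rw [← Finset.sum_congr rfl e, h]
    rcases eq_or_ne i j with rfl | hij
    · rw [if_pos rfl]
      refine Finset.sum_eq_zero fun a ha => Finset.sum_eq_zero fun b _ => ?_
      rw [if_neg fun h => (Finset.mem_filter.1 ha).2 h.2]
    · rw [if_neg hij, Finset.sum_eq_single_of_mem j (by simp [hij.symm])]
      · simp only [and_true]
        rw [← Finset.sum_filter, Finset.sum_const, nsmul_eq_mul, mul_one, Finset.filter_filter]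
        have hset : (Finset.univ.filter fun b => b ≠ i ∧ j < b) = (Finset.Ioi j).erase i := by
          ext b; simp
        have hj := j.2
        rw [hset, Finset.card_erase_eq_ite, Fin.card_Ioi]
        simp only [Finset.mem_Ioi]
        split_ifs with hlt
        · have := i.2
          have : (j : ℕ) < i := hlt
          omega
        · omega
      · intro a _ ha
        exact Finset.sum_eq_zero fun b _ => if_neg fun h => ha h.2
  simp only [expMatrix, Matrix.of_apply]
  rw [(hasInitial_dysonVar r i).order_eq fun s hs => nonneg_of_mem_ratioMonoid hs, coord_add,
    coord_zsmul, coord_sum]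
  simp only [coord_basis]
  rw [hsum, dysonExpMatrix, Matrix.of_apply]
  split_ifs <;> ring

lemma div_sub_rev {F : Type*} [Field F] (x y : F) : y / (y - x) = -(y / (x - y)) := by
  rw [← neg_sub x y, div_neg]

lemma logDer_var (i j : Fin n) : logDer (euler K j) (var K i) = if i = j then 1 else 0 := by
  rw [logDer, euler_var]
  split_ifs
  · exact div_self (var_ne_zero i)
  · exact zero_div _

lemma logJacobianMatrix_dysonVar (r : ℤ) :
    logJacobianMatrix (fun j : Fin n => euler K j) (dysonVar K n r) =
      dysonLogMatrix (n := n) r (var K) := by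
  ext1 i j
  set D := euler K j with hD
  have hsub : ∀ p ∈ Finset.univ.filter
      fun p : Fin n × Fin n => p.1 < p.2 ∧ p.1 ≠ i ∧ p.2 ≠ i, var K p.1 - var K p.2 ≠ 0 :=
    fun p hp => (hasInitial_var_sub_var (Finset.mem_filter.1 hp).2.1).ne_zero
  set h : Fin n → Fin n → MNSeries n K := fun a b =>
    if a = j then var K a / (var K a - var K b) else 0 with hh
  -- The logarithmic derivative of `z_a - z_b` is the symmetrization of `h`.
  have h1 : logDer D (vandermondeOmit K i) =
      if i = j then 0 else ∑ k with k ≠ i, var K j / (var K j - var K k) := by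
    have e : ∀ p ∈ Finset.univ.filter
        fun p : Fin n × Fin n => p.1 < p.2 ∧ p.1 ≠ i ∧ p.2 ≠ i,
        logDer D (var K p.1 - var K p.2) = h p.1 p.2 + h p.2 p.1 := by
      intro p _
      rw [logDer, map_sub, hD, euler_var, euler_var, hh, sub_div]
      simp only
      rw [div_sub_rev (var K p.1) (var K p.2)]
      split_ifs <;> simp [sub_eq_add_neg]
    rw [vandermondeOmit, logDer_prod D _ _ hsub, Finset.sum_congr rfl e,
      sum_sum_eq_sum_lt h (fun a => by simp [hh]) fun a => a ≠ i]
    rcases eq_or_ne i j with rfl | hij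
    · rw [if_pos rfl]
      refine Finset.sum_eq_zero fun a ha => Finset.sum_eq_zero fun b _ => ?_
      exact if_neg (Finset.mem_filter.1 ha).2
    · rw [if_neg hij, Finset.sum_eq_single_of_mem j (by simp [hij.symm])]
      · simp [hh]
      · intro a _ ha
        exact Finset.sum_eq_zero fun b _ => if_neg ha
  have h2 : logDer D (dysonVar K n r i) =
      logDer D (var K i ^ r * vandermondeOmit K i) := by
    rw [dysonVar, mul_assoc]
    rcases neg_one_pow_eq_or (MNSeries n K) (i : ℕ) with h | h <;> rw [h]
    · rw [one_mul]
    · rw [neg_one_mul, logDer_neg]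
  have hV : vandermondeOmit K i ≠ 0 := Finset.prod_ne_zero_iff.2 hsub
  rw [logJacobianMatrix, Matrix.of_apply, h2, logDer_mul D (zpow_ne_zero _ (var_ne_zero i)) hV,
    logDer_zpow D (var_ne_zero i), logDer_var, h1,
    dysonLogMatrix, Matrix.of_apply]
  split_ifs <;> simp

/-- The log Jacobian as a constant; the value is reduced modulo the characteristic of `K`. -/
lemma logJacobian_dysonVar (N : ℕ) (r : ℤ) :
    logJacobian (dysonVar K (N + 1) r) = HahnSeries.C
      (((∏ i ∈ Finset.range N, (r - (i : ℤ))) * (r + (N.choose 2 : ℤ)) : ℤ) : K) := by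
  rw [logJacobian_eq_det, logJacobianMatrix_dysonVar,
    det_dysonLogMatrix N r _ (var_injective K), map_intCast]

end Dyson

/-! ### Constant terms of monomials -/

section ConstantTerm

/-- Extension of the coefficients from `ℤ` to `K`. -/
def intMap (n : ℕ) (K : Type*) [Field K] : HahnSeries (ExpGroup n) ℤ →+* MNSeries n K where
  toFun x := x.map (Int.castRingHom K)
  map_zero' := by ext; simp
  map_one' := by ext; simp [HahnSeries.coeff_one]
  map_add' x y := by ext; simp
  map_mul' x y := HahnSeries.map_mul (Int.castRingHom K : ℤ →ₙ+* K)

lemma coeff_intMap (x : HahnSeries (ExpGroup n) ℤ) (m : ExpGroup n) :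
    (intMap n K x).coeff m = (x.coeff m : K) := rfl

lemma intMap_single (a : ExpGroup n) :
    intMap n K (HahnSeries.single a 1) = HahnSeries.single a 1 := by
  ext m
  rw [coeff_intMap, HahnSeries.coeff_single, HahnSeries.coeff_single]
  split_ifs <;> simp

/-- `f` and `g` are the images over the fields `K` and `K'` of one and the same invertible series
with integer coefficients. -/
def HaveCommonIntegralForm {K' : Type*} [Field K'] (f : MNSeries n K) (g : MNSeries n K') : Prop :=
  ∃ U : (HahnSeries (ExpGroup n) ℤ)ˣ, intMap n K U = f ∧ intMap n K' U = g

namespace HaveCommonIntegralForm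

variable {K' : Type*} [Field K'] {f f' : MNSeries n K} {g g' : MNSeries n K'}

lemma one : HaveCommonIntegralForm (1 : MNSeries n K) (1 : MNSeries n K') :=
  ⟨1, by simp, by simp⟩

lemma neg_one : HaveCommonIntegralForm (-1 : MNSeries n K) (-1 : MNSeries n K') :=
  ⟨-1, by simp, by simp⟩

lemma mul (h : HaveCommonIntegralForm f g) (h' : HaveCommonIntegralForm f' g') :
    HaveCommonIntegralForm (f * f') (g * g') := by
  obtain ⟨U, rfl, rfl⟩ := h
  obtain ⟨V, rfl, rfl⟩ := h'
  exact ⟨U * V, by simp, by simp⟩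

lemma pow (h : HaveCommonIntegralForm f g) (k : ℕ) :
    HaveCommonIntegralForm (f ^ k) (g ^ k) := by
  obtain ⟨U, rfl, rfl⟩ := h
  exact ⟨U ^ k, by simp, by simp⟩

lemma zpow (h : HaveCommonIntegralForm f g) (k : ℤ) :
    HaveCommonIntegralForm (f ^ k) (g ^ k) := by
  obtain ⟨U, rfl, rfl⟩ := h
  refine ⟨U ^ k, ?_, ?_⟩
  · have := congrArg Units.val (map_zpow (Units.map (intMap n K).toMonoidHom) U k)
    rwa [Units.val_zpow_eq_zpow_val] at this
  · have := congrArg Units.val (map_zpow (Units.map (intMap n K').toMonoidHom) U k)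
    rwa [Units.val_zpow_eq_zpow_val] at this

lemma prod {ι : Type*} (s : Finset ι) {f : ι → MNSeries n K} {g : ι → MNSeries n K'}
    (h : ∀ i ∈ s, HaveCommonIntegralForm (f i) (g i)) :
    HaveCommonIntegralForm (∏ i ∈ s, f i) (∏ i ∈ s, g i) := by
  classical
  induction s using Finset.induction_on with
  | empty => simpa using one
  | insert i s hi ih =>
    rw [Finset.prod_insert hi, Finset.prod_insert hi]
    exact (h i (by simp)).mul (ih fun j hj => h j (by simp [hj]))

lemma var (K K' : Type*) [Field K] [Field K'] (j : Fin n) :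
    HaveCommonIntegralForm (MalcevNeumann.var K j) (MalcevNeumann.var K' j) := by
  have hu : IsUnit (HahnSeries.single (ExpGroup.basis j) (1 : ℤ)) := by
    rw [HahnSeries.isUnit_iff, HahnSeries.leadingCoeff_of_single]
    exact isUnit_one
  exact ⟨hu.unit, intMap_single _, intMap_single _⟩

lemma var_sub_var (K K' : Type*) [Field K] [Field K'] {a b : Fin n} (h : a < b) :
    HaveCommonIntegralForm (MalcevNeumann.var K a - MalcevNeumann.var K b)
      (MalcevNeumann.var K' a - MalcevNeumann.var K' b) := by
  have hu : IsUnit (HahnSeries.single (ExpGroup.basis a) (1 : ℤ) -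
      HahnSeries.single (ExpGroup.basis b) (1 : ℤ)) := by
    rw [HahnSeries.isUnit_iff, HahnSeries.leadingCoeff_sub, HahnSeries.leadingCoeff_of_single]
    · exact isUnit_one
    · rw [HahnSeries.orderTop_single one_ne_zero, HahnSeries.orderTop_single one_ne_zero]
      exact WithTop.coe_lt_coe.2 (basis_lt_basis h)
  refine ⟨hu.unit, ?_, ?_⟩ <;> rw [IsUnit.unit_spec, map_sub, intMap_single, intMap_single] <;> rfl

lemma dysonVar (K K' : Type*) [Field K] [Field K'] (r : ℤ) (i : Fin n) :
    HaveCommonIntegralForm (MalcevNeumann.dysonVar K n r i)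
      (MalcevNeumann.dysonVar K' n r i) :=
  ((neg_one.pow _).mul ((var K K' i).zpow r)).mul
    (prod _ fun _ hp => var_sub_var K K' (Finset.mem_filter.1 hp).2.1)

lemma coeff_eq_zero [CharZero K] (h : HaveCommonIntegralForm f g) {m : ExpGroup n}
    (hm : f.coeff m = 0) : g.coeff m = 0 := by
  obtain ⟨U, rfl, rfl⟩ := h
  rw [coeff_intMap] at hm ⊢
  rw [Int.cast_eq_zero.1 hm, Int.cast_zero]

end HaveCommonIntegralForm

/-- The constant term of a nontrivial monomial in the `u_i^{(r)}` vanishes. Over `ℚ` this is the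
residue formula, because the log Jacobian is a nonzero constant; as the coefficients of the
monomial are integers that do not depend on the field, it follows in every characteristic. -/
theorem coeff_zero_prod_dysonVar_zpow (N : ℕ) (r : ℤ)
    (hr : (∏ i ∈ Finset.range N, (r - (i : ℤ))) * (r + (N.choose 2 : ℤ)) ≠ 0)
    (k : Fin (N + 1) → ℤ) (hk : k ≠ 0) :
    (∏ i, dysonVar K (N + 1) r i ^ k i).coeff 0 = 0 := by
  refine HaveCommonIntegralForm.coeff_eq_zero (K := ℚ)
    (HaveCommonIntegralForm.prod Finset.univ fun i _ =>
      (HaveCommonIntegralForm.dysonVar ℚ K r i).zpow (k i)) ?_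
  obtain ⟨i₀, hi₀⟩ := Function.ne_iff.1 hk
  have h := zsmul_map_monomial_mul_det_eq_zero (HahnSeries.coeff.addMonoidHom 0)
    (fun j => euler ℚ j) constTerm_euler euler_comm (dysonVar ℚ (N + 1) r)
    (dysonVar_ne_zero r) k i₀
  rw [← logJacobian_eq_det, logJacobian_dysonVar, mul_comm, HahnSeries.C_mul_eq_smul] at h
  change k i₀ • ((((∏ i ∈ Finset.range N, (r - (i : ℤ))) * (r + (N.choose 2 : ℤ)) : ℤ) : ℚ) •
    (∏ i, dysonVar ℚ (N + 1) r i ^ k i).coeff 0) = 0 at h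
  exact ((smul_eq_zero.1 ((smul_eq_zero.1 h).resolve_left hi₀)).resolve_left
    (Int.cast_ne_zero.2 hr))

/-- The matrix of `ρ` is the transpose of the matrix of initial exponents. -/
lemma initialHom_injective (F : Fin n → MNSeries n K) (hF : jacobianNumber F ≠ 0) :
    Function.Injective (initialHom F) := by
  rw [injective_iff_map_eq_zero]
  intro k hk
  refine Matrix.eq_zero_of_vecMul_eq_zero hF ?_
  funext j
  have h := congrArg (fun m => ExpGroup.coord m j) hk
  change (∑ i, k i • (F i).order).coord j = 0 at h
  rw [coord_sum] at h
  simp only [coord_zsmul] at h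
  exact h

end ConstantTerm

end MalcevNeumann

end

/-! ### The constant term theorem -/

theorem mainTheorem3 {K : Type*} [Field K] (n : ℕ) (hn : 1 ≤ n) (r : ℤ) :
    MalcevNeumann.jacobianNumber (MalcevNeumann.dysonVar K n r)
        = (∏ i ∈ Finset.range (n - 1), (r - (i : ℤ))) * (r + ((n - 1).choose 2 : ℤ)) ∧
    MalcevNeumann.logJacobian (MalcevNeumann.dysonVar K n r)
        = HahnSeries.C
            (MalcevNeumann.jacobianNumber (MalcevNeumann.dysonVar K n r) : K) ∧
    ((∀ i : ℕ, i + 2 ≤ n → r ≠ (i : ℤ)) → r ≠ -((n - 1).choose 2 : ℤ) →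
      Function.Injective
          (MalcevNeumann.initialHom (MalcevNeumann.dysonVar K n r)) ∧
      ∀ Φ : MalcevNeumann.FormalSeries n K,
        MalcevNeumann.IsInducedMN
          (MalcevNeumann.initialHom (MalcevNeumann.dysonVar K n r)) Φ →
        ∃ η : MalcevNeumann.MNSeries n K,
          MalcevNeumann.HasComp Φ (MalcevNeumann.dysonVar K n r) η ∧
          MalcevNeumann.constTerm η = Φ.constTerm) := by
  obtain ⟨N, rfl⟩ : ∃ N, n = N + 1 := ⟨n - 1, by omega⟩
  simp only [Nat.add_sub_cancel]
  have hj : MalcevNeumann.jacobianNumber (MalcevNeumann.dysonVar K (N + 1) r) =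
      (∏ i ∈ Finset.range N, (r - (i : ℤ))) * (r + (N.choose 2 : ℤ)) := by
    rw [MalcevNeumann.jacobianNumber, MalcevNeumann.expMatrix_dysonVar,
      MalcevNeumann.det_dysonExpMatrix]
  refine ⟨hj, by rw [hj, MalcevNeumann.logJacobian_dysonVar], fun hr1 hr2 => ?_⟩
  have hr : (∏ i ∈ Finset.range N, (r - (i : ℤ))) * (r + (N.choose 2 : ℤ)) ≠ 0 := by
    refine mul_ne_zero (Finset.prod_ne_zero_iff.2 fun i hi => ?_) fun h => ?_
    · exact sub_ne_zero.2 (hr1 i (by have := Finset.mem_range.1 hi; omega))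
    · exact hr2 (eq_neg_of_add_eq_zero_left h)
  have hinj := MalcevNeumann.initialHom_injective _ (hj.trans_ne hr)
  refine ⟨hinj, fun Φ hΦ => ?_⟩
  obtain ⟨η, hη⟩ := MalcevNeumann.exists_hasComp (MalcevNeumann.isPWO_ratioMonoid (N + 1))
    (fun s hs => MalcevNeumann.nonneg_of_mem_ratioMonoid hs) _
    (fun i => ⟨_, MalcevNeumann.hasInitial_dysonVar r i⟩) hinj Φ hΦ
  refine ⟨η, hη, ?_⟩
  rw [MalcevNeumann.constTerm, ← (hη 0).2, finsum_eq_single _ 0 fun k hk => ?_]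
  · simp [MalcevNeumann.FormalSeries.constTerm, HahnSeries.coeff_one]
  · rw [HahnSeries.coeff_smul, MalcevNeumann.coeff_zero_prod_dysonVar_zpow N r hr k hk, smul_zero]
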